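/- Theorem. There is an absolute constant $C>0$ such that the following holds. Let $k,m\ge 1$ be integers, let $\alpha\in(0,1]$ and $\varepsilon>0$, and suppose that $m\le \sqrt{k}/\alpha^2$. Then there is an integer $$n_0\;\le\; C\cdot\frac{k}{m\,\alpha^2\min(\varepsilon,1)^2}$$ (so $n_0=O\big(k/(m\alpha^2\varepsilon^2)\big)$ for $\varepsilon\le 1$) such that for every $n\ge n_0$ there is an asymmetric, public-coin, user-level $\varepsilon$-locally differentially private uniformity tester over $[k]=\{1,\dots,k\}$ with distance parameter $\alpha$ for $n$ users, each holding $m$ samples and sending one bit. Here an asymmetric public-coin protocol with one bit per user works as follows. A random seed $S$, of a fixed discrete law, is published to all users and to the server; independently of it, user $i$ ($1\le i\le n$) receives $X_i\in[k]^m$, with all $nm$ samples i.i.d. from an unknown distribution $p$ on $[k]$, and sends one bit $Y_i\in\{0,1\}$, drawn with private randomness from a distribution $W_i(\cdot\mid S,X_i)$ (which may depend on $i$); the server accepts or rejects as a function of $(S,Y_1,\dots,Y_n)$. It is user-level $\varepsilon$-locally differentially private if $W_i(y\mid s,x)\le e^{\varepsilon}\,W_i(y\mid s,x')$ for all users $i$,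 all seeds $s$, all $x,x'\in[k]^m$ and all $y\in\{0,1\}$. It is a uniformity tester with distance parameter $\alpha$ if it accepts with probability at least $2/3$ when $p$ is the uniform distribution $u_k$ on $[k]$, and rejects with probability at least $2/3$ for every $p$ with $d_{\mathrm{TV}}(p,u_k)=\frac12\sum_{x\in[k]}|p(x)-1/k|\ge\alpha$. -/

import Mathlib

open scoped ENNReal

noncomputable section

namespace UserLevelLDP

/-- The joint law of finitely many independent random variables `x i ∼ q i` with values in a
finite set: the tuple `x` has probability `∏ i, q i (x i)`. -/
def productPMF {ι β : Type} [Fintype ι] [DecidableEq ι] [Fintype β] (q : ι → PMF β) :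
    PMF (ι → β) :=
  PMF.ofFintype (fun x => ∏ i, q i (x i)) (by
    rw [← Fintype.prod_sum]
    exact Finset.prod_eq_one fun i _ => (tsum_fintype (q i)).symm.trans (q i).tsum_coe)

/-- The total variation distance of two distributions on a finite set, as half the `ℓ¹` distance. -/
def dTV {β : Type} [Fintype β] (p q : PMF β) : ℝ :=
  (1 / 2) * ∑ x, |(p x).toReal - (q x).toReal|

/-- A randomized algorithm `Q : D → R` (with discrete output) is `ε`-locally differentially
private if `Pr[Q(x) = y] ≤ e^ε Pr[Q(x') = y]` for all inputs `x, x'` and all outputs `y`. -/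
def IsLDP {D R : Type} (ε : ℝ) (Q : D → PMF R) : Prop :=
  ∀ (x x' : D) (y : R), Q x y ≤ ENNReal.ofReal (Real.exp ε) * Q x' y

/-- A non-interactive public-coin protocol with `n` users, each of which holds `m` samples from a
domain of size `k` and sends one message from the alphabet `Msg` to a server.

* `coin` is the law of the public random seed, which all users and the server see;
* `randomizer i s` is the randomized map (using private coins) by which user `i` turns its `m`
  samples into its message when the seed is `s`; it may be different for different users, so
  the protocol is allowed to be asymmetric;
* `referee s` is the server's decision from the messages when the seed is `s`; `true` means
  "accept" (the unknown distribution is uniform) and `false` means "reject". -/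
structure PublicCoinProtocol (n m k : ℕ) (Msg : Type) where
  Seed : Type
  coin : PMF Seed
  randomizer : Fin n → Seed → (Fin m → Fin k) → PMF Msg
  referee : Seed → (Fin n → Msg) → Bool

namespace PublicCoinProtocol

variable {n m k : ℕ} {Msg : Type}

/-- The law of the server's decision when the samples of all users are i.i.d. from `p`.
First the seed `s` is drawn; independently of it, the `n` users receive independent
multi-samples `X i ∼ p^{⊗ m}`; given these, user `i` sends a message drawn from
`randomizer i s (X i)`, independently of the other users; then the server decides. -/
def decisionLaw [Fintype Msg] (P : PublicCoinProtocol n m k Msg) (p : PMF (Fin k)) : PMF Bool :=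
  P.coin.bind fun s =>
    (productPMF fun _ : Fin n => productPMF fun _ : Fin m => p).bind fun X =>
      (productPMF fun i : Fin n => P.randomizer i s (X i)).map (P.referee s)

/-- User-level `ε`-local differential privacy: for every value of the public seed, the message of
every user is `ε`-locally differentially private as a function of the user's whole
collection of `m` samples. -/
def IsUserLevelLDP (P : PublicCoinProtocol n m k Msg) (ε : ℝ) : Prop :=
  ∀ (i : Fin n) (s : P.Seed), IsLDP ε (P.randomizer i s)

/-- The protocol solves uniformity testing with distance parameter `α`: with probability at least
`2/3`, it accepts if the unknown distribution is uniform, and it rejects if the unknown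
distribution is at total variation distance at least `α` from uniform. -/
def IsUniformityTester [NeZero k] [Fintype Msg] (P : PublicCoinProtocol n m k Msg) (α : ℝ) :
    Prop :=
  2 / 3 ≤ P.decisionLaw (PMF.uniformOfFintype (Fin k)) true ∧
    ∀ p : PMF (Fin k), α ≤ dTV p (PMF.uniformOfFintype (Fin k)) →
      2 / 3 ≤ P.decisionLaw p false

end PublicCoinProtocol

end UserLevelLDP

end

namespace UserLevelLDP

/-! Public random signs `σ` reduce the problem to a one-dimensional one. If `p` is `α`-far from
uniform, Cauchy–Schwarz and a fourth-moment bound show that the means of `σ` under `p` and under the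
uniform distribution differ by at least `δ = α / √k` with probability at least 3/16
(`expectation_signPMF_meanSign_close_le`). Each user sums the centred signs of its `m` samples,
clips at scale `√m` and sends a bit whose bias is proportional to the result.

The crux is that clipping costs only a constant factor: since `m * δ ^ 2 ≤ 1`, the drift `m * δ` is
at most the noise scale `√m`, and the clipped mean still moves by order `m * δ`
(`walkStep_pow_clip_abs_gap`). The bit probability thus moves by `γ` of order `min ε 1 * δ * √m`,
and Chebyshev detects this with order `1 / γ ^ 2` users. Ten groups with independent signs amplify
the constant success probability. -/

/-- The expectation of a real function under a distribution on a finite set. -/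
noncomputable def expectation {β : Type} [Fintype β] (p : PMF β) (f : β → ℝ) : ℝ :=
  ∑ x, (p x).toReal * f x

/-! ### Expectations under finite and product distributions. -/

section Expectation

variable {β γ : Type} [Fintype β] [Fintype γ]

theorem sum_toReal_pmf (p : PMF β) : ∑ x, (p x).toReal = 1 := by
  rw [← ENNReal.toReal_sum fun x _ => p.apply_ne_top x, ← tsum_fintype (L := .unconditional β),
    p.tsum_coe, ENNReal.toReal_one]

theorem expectation_const (p : PMF β) (c : ℝ) : expectation p (fun _ => c) = c := by
  simp [expectation, ← Finset.sum_mul, sum_toReal_pmf]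

theorem expectation_add (p : PMF β) (f g : β → ℝ) :
    expectation p (fun x => f x + g x) = expectation p f + expectation p g := by
  simp [expectation, mul_add, Finset.sum_add_distrib]

theorem expectation_const_mul (p : PMF β) (c : ℝ) (f : β → ℝ) :
    expectation p (fun x => c * f x) = c * expectation p f := by
  simp only [expectation, Finset.mul_sum]
  exact Finset.sum_congr rfl fun x _ => by ring

theorem expectation_sum {ι : Type} (s : Finset ι) (p : PMF β) (f : ι → β → ℝ) :
    expectation p (fun x => ∑ i ∈ s, f i x) = ∑ i ∈ s, expectation p (f i) := by
  simp only [expectation, Finset.mul_sum]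
  exact Finset.sum_comm

theorem expectation_mono (p : PMF β) {f g : β → ℝ} (h : ∀ x, f x ≤ g x) :
    expectation p f ≤ expectation p g :=
  Finset.sum_le_sum fun x _ => mul_le_mul_of_nonneg_left (h x) ENNReal.toReal_nonneg

theorem expectation_bind (p : PMF β) (q : β → PMF γ) (f : γ → ℝ) :
    expectation (p.bind q) f = expectation p fun x => expectation (q x) f := by
  have h (y : γ) : (p.bind q y).toReal = ∑ x, (p x).toReal * (q x y).toReal := by
    rw [PMF.bind_apply, tsum_fintype, ENNReal.toReal_sum
      fun x _ => ENNReal.mul_ne_top (p.apply_ne_top x) ((q x).apply_ne_top y)]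
    simp [ENNReal.toReal_mul]
  simp only [expectation, h, Finset.sum_mul, Finset.mul_sum]
  rw [Finset.sum_comm]
  exact Finset.sum_congr rfl fun x _ => Finset.sum_congr rfl fun y _ => by ring

theorem expectation_pure (x : β) (f : β → ℝ) : expectation (PMF.pure x) f = f x := by
  classical
  rw [expectation, Finset.sum_eq_single x]
  · simp
  · intro y _ hy
    simp [PMF.pure_apply, hy]
  · simp

theorem expectation_map (p : PMF β) (g : β → γ) (f : γ → ℝ) :
    expectation (p.map g) f = expectation p fun x => f (g x) := by
  rw [← PMF.bind_pure_comp, expectation_bind]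
  simp [expectation_pure]

theorem toReal_apply_eq_expectation [DecidableEq β] (p : PMF β) (x : β) :
    (p x).toReal = expectation p fun y => if y = x then 1 else 0 := by
  simp [expectation]

theorem toReal_productPMF {ι : Type} [Fintype ι] [DecidableEq ι] (q : ι → PMF β) (x : ι → β) :
    (productPMF q x).toReal = ∏ i, (q i (x i)).toReal := by
  rw [productPMF, PMF.ofFintype_apply, ENNReal.toReal_prod]

theorem expectation_productPMF_prod {ι : Type} [Fintype ι] [DecidableEq ι] (q : ι → PMF β)
    (f : ι → β → ℝ) :
    expectation (productPMF q) (fun x => ∏ i, f i (x i)) = ∏ i, expectation (q i) (f i) := by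
  simp only [expectation, toReal_productPMF, ← Finset.prod_mul_distrib]
  exact (Fintype.prod_sum fun i x => (q i x).toReal * f i x).symm

theorem expectation_productPMF_eval {ι : Type} [Fintype ι] [DecidableEq ι] (q : ι → PMF β)
    (i : ι) (f : β → ℝ) :
    expectation (productPMF q) (fun x => f (x i)) = expectation (q i) f := by
  have h := expectation_productPMF_prod q fun j x => if j = i then f x else 1
  rw [Fintype.prod_eq_single i] at h
  · simpa using h
  · intro j hj
    simp [hj, expectation_const]

theorem expectation_productPMF_succ {n : ℕ} (q : Fin (n + 1) → PMF β)
    (f : (Fin (n + 1) → β) → ℝ) :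
    expectation (productPMF q) f = expectation (q 0) fun a =>
      expectation (productPMF fun i : Fin n => q i.succ) fun x => f (Fin.cons a x) := by
  simp only [expectation, toReal_productPMF, Finset.mul_sum]
  rw [← Fintype.sum_prod_type', ← (Fin.consEquiv fun _ : Fin (n + 1) => β).sum_comp]
  refine Fintype.sum_congr _ _ fun x => ?_
  simp [Fin.consEquiv, Fin.prod_univ_succ, mul_assoc]

/-- Averaging out the users' samples leaves independent messages once the seed is fixed. -/
theorem productPMF_bind {ι : Type} [Fintype ι] [DecidableEq ι] (q : ι → PMF β)
    (r : ι → β → PMF γ) :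
    ((productPMF q).bind fun x => productPMF fun i => r i (x i)) =
      productPMF fun i => (q i).bind (r i) := by
  ext y
  simp only [PMF.bind_apply, tsum_fintype, productPMF, PMF.ofFintype_apply,
    ← Finset.prod_mul_distrib]
  exact (Fintype.prod_sum fun i x => q i x * r i x (y i)).symm

/-- The variance of a sum of independent centred variables is the sum of their variances. -/
theorem expectation_productPMF_sum_sq {n : ℕ} (q : Fin n → PMF β) (a : Fin n → β → ℝ)
    (ha : ∀ i, expectation (q i) (a i) = 0) :
    expectation (productPMF q) (fun x => (∑ i, a i (x i)) ^ 2) =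
      ∑ i, expectation (q i) fun y => a i y ^ 2 := by
  induction n with
  | zero => simp [expectation_const]
  | succ n ih =>
    have h := ih (fun i => q i.succ) (fun i => a i.succ) fun i => ha i.succ
    rw [expectation_productPMF_succ, Fin.sum_univ_succ, ← h]
    have hmean : expectation (productPMF fun i : Fin n => q i.succ)
        (fun x => ∑ i, a i.succ (x i)) = 0 := by
      rw [expectation_sum]
      refine Finset.sum_eq_zero fun i _ => ?_
      exact (expectation_productPMF_eval (fun i : Fin n => q i.succ) i (a i.succ)).trans
        (ha i.succ)
    simp only [Fin.sum_univ_succ, Fin.cons_zero, Fin.cons_succ, add_sq, expectation_add,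
      mul_assoc, expectation_const_mul, hmean, expectation_const, mul_zero, add_zero]

/-- Chebyshev's inequality. -/
theorem expectation_indicator_le_div_sq (p : PMF β) (f : β → ℝ) {τ V : ℝ} (hτ : 0 < τ)
    (hV : expectation p (fun x => f x ^ 2) ≤ V) :
    expectation p (fun x => if τ ≤ |f x| then 1 else 0) ≤ V / τ ^ 2 := by
  rw [le_div_iff₀ (by positivity), mul_comm, ← expectation_const_mul]
  refine (expectation_mono p fun x => ?_).trans hV
  split_ifs with h
  · rw [mul_one, ← sq_abs (f x)]
    exact pow_le_pow_left₀ hτ.le h 2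
  · rw [mul_zero]
    positivity

end Expectation

/-! ### Biased random walks as commuting averaging operators. -/

/-- One step of a random walk on `ℝ` with increments `±1 - c` and mean increment `b - c`,
as an averaging operator on functions. -/
noncomputable def walkStep (c b : ℝ) : Module.End ℝ (ℝ → ℝ) :=
  ((1 + b) / 2) • LinearMap.funLeft ℝ ℝ (fun z => z + (1 - c)) +
    ((1 - b) / 2) • LinearMap.funLeft ℝ ℝ (fun z => z + (-1 - c))

theorem walkStep_apply (c b : ℝ) (f : ℝ → ℝ) (z : ℝ) :
    walkStep c b f z = (1 + b) / 2 * f (z + (1 - c)) + (1 - b) / 2 * f (z + (-1 - c)) := by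
  simp [walkStep, LinearMap.funLeft_apply]

theorem walkStep_commute (c b b' : ℝ) : Commute (walkStep c b) (walkStep c b') := by
  refine LinearMap.ext fun f => funext fun z => ?_
  simp only [Module.End.mul_apply, walkStep_apply, add_assoc]
  rw [show 1 - c + (-1 - c) = -1 - c + (1 - c) by ring]
  ring

theorem walkStep_mono {c b : ℝ} (hb : |b| ≤ 1) {f g : ℝ → ℝ} (h : f ≤ g) :
    walkStep c b f ≤ walkStep c b g := by
  intro z
  obtain ⟨h₁, h₂⟩ := abs_le.mp hb
  rw [walkStep_apply, walkStep_apply]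
  exact add_le_add (mul_le_mul_of_nonneg_left (h _) (by linarith))
    (mul_le_mul_of_nonneg_left (h _) (by linarith))

theorem walkStep_pow_mono {c b : ℝ} (hb : |b| ≤ 1) (n : ℕ) {f g : ℝ → ℝ} (h : f ≤ g) :
    (walkStep c b ^ n) f ≤ (walkStep c b ^ n) g := by
  induction n with
  | zero => simpa using h
  | succ n ih =>
    rw [pow_succ', Module.End.mul_apply, Module.End.mul_apply]
    exact walkStep_mono hb ih

/-- A step preserves this family of parabolas: `D` accumulates the mean displacement and `V` the
variance. -/
theorem walkStep_pow_parabola (c b r s D V : ℝ) (n : ℕ) :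
    (walkStep c b ^ n) (fun z => r + s * ((z + D) ^ 2 + V)) =
      fun z => r + s * ((z + (D + n * (b - c))) ^ 2 + (V + n * (1 - b ^ 2))) := by
  induction n with
  | zero => simp
  | succ n ih =>
    rw [pow_succ', Module.End.mul_apply, ih]
    funext z
    rw [walkStep_apply]
    push_cast
    ring

/-- Telescoping: commuting operators satisfy the geometric-sum identity, and the difference of two
steps is a multiple of a discrete difference. Steps of the walk are exchanged one at a time. -/
theorem walkStep_pow_sub_pow (c b b' : ℝ) (m : ℕ) (f : ℝ → ℝ) (z : ℝ) :
    (walkStep c b' ^ m) f z - (walkStep c b ^ m) f z =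
      ∑ i ∈ Finset.range m, (b' - b) / 2 * (walkStep c b' ^ i) ((walkStep c b ^ (m - 1 - i))
        fun z => f (z + (1 - c)) - f (z + (-1 - c))) z := by
  have h := (walkStep_commute c b' b).geom_sum₂_mul m
  have hD : (walkStep c b' - walkStep c b) f =
      ((b' - b) / 2) • fun z => f (z + (1 - c)) - f (z + (-1 - c)) := by
    funext z
    simp only [LinearMap.sub_apply, Pi.sub_apply, walkStep_apply, Pi.smul_apply, smul_eq_mul]
    ring
  have h' := congrFun (LinearMap.congr_fun h f) z
  rw [LinearMap.sub_apply, Pi.sub_apply] at h'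
  rw [← h', Module.End.mul_apply, hD, LinearMap.sum_apply, Finset.sum_apply]
  refine Finset.sum_congr rfl fun i _ => ?_
  rw [map_smul, Pi.smul_apply, smul_eq_mul, Module.End.mul_apply]

/-! ### Response of a clipped walk to its drift. -/

/-- Truncation of a real number to `[-M, M]`. -/
noncomputable def clip (M z : ℝ) : ℝ := max (-M) (min M z)

theorem abs_clip_le {M : ℝ} (hM : 0 ≤ M) (z : ℝ) : |clip M z| ≤ M :=
  abs_le.mpr ⟨le_max_left _ _, max_le (by linarith) (min_le_left _ _)⟩

theorem clip_mono (M : ℝ) : Monotone (clip M) :=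
  fun _ _ h => max_le_max le_rfl (min_le_min le_rfl h)

theorem clip_of_abs_le {M z : ℝ} (h : |z| ≤ M) : clip M z = z := by
  obtain ⟨h₁, h₂⟩ := abs_le.mp h
  rw [clip, min_eq_right h₂, max_eq_right h₁]

/-- For `|z| ≤ R` neither point is clipped and the difference is exactly 2; beyond that the parabola
is nonpositive while `clip` is monotone. The zeros match the form of `walkStep_pow_parabola`. -/
theorem clip_sub_clip_lower {R c : ℝ} (hR : 0 < R) (hc : |c| ≤ 1) (z : ℝ) :
    2 + -(2 / R ^ 2) * ((z + 0) ^ 2 + 0) ≤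
      clip (R + 2) (z + (1 - c)) - clip (R + 2) (z + (-1 - c)) := by
  obtain ⟨h₁, h₂⟩ := abs_le.mp hc
  rcases le_total |z| R with h | h
  · obtain ⟨h₃, h₄⟩ := abs_le.mp h
    rw [clip_of_abs_le (abs_le.mpr ⟨by linarith, by linarith⟩),
      clip_of_abs_le (abs_le.mpr ⟨by linarith, by linarith⟩)]
    have : 0 ≤ 2 / R ^ 2 * z ^ 2 := by positivity
    linarith
  · have h₃ : clip (R + 2) (z + (-1 - c)) ≤ clip (R + 2) (z + (1 - c)) :=
      clip_mono _ (by linarith)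
    have h₄ : 1 ≤ z ^ 2 / R ^ 2 := by
      rw [one_le_div (by positivity), ← sq_abs z]
      exact pow_le_pow_left₀ hR.le h 2
    have h₅ : 2 / R ^ 2 * z ^ 2 = 2 * (z ^ 2 / R ^ 2) := by ring
    rw [add_zero, add_zero]
    linarith

theorem walkStep_pow_clip_mono {c b b' R : ℝ} (hb : |b| ≤ 1)
    (hb' : |b'| ≤ 1) (h : b ≤ b') (m : ℕ) :
    (walkStep c b ^ m) (clip R) 0 ≤ (walkStep c b' ^ m) (clip R) 0 := by
  rw [← sub_nonneg, walkStep_pow_sub_pow]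
  refine Finset.sum_nonneg fun i _ => mul_nonneg (by linarith) ?_
  have h₀ : (0 : ℝ → ℝ) ≤ fun z => clip R (z + (1 - c)) - clip R (z + (-1 - c)) :=
    fun z => sub_nonneg.mpr (clip_mono _ (by linarith))
  have := walkStep_pow_mono (c := c) hb' i (walkStep_pow_mono (c := c) hb (m - 1 - i) h₀)
  simpa using this 0

/-- Each telescoping term averages a discrete difference of `clip` along a walk with mixed drifts.
The parabola minorant turns this into a second-moment computation: squared mean and variance are
each at most `m`, so with `R ^ 2 = 4 * m` the average is at least `2 - 1 = 1`. -/
theorem walkStep_pow_clip_gap {c b b' δ : ℝ} {m : ℕ} (hm : 1 ≤ m) (hc : |c| ≤ 1)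
    (hb : |b| ≤ 1) (hb' : |b'| ≤ 1) (h : b ≤ b') (hbc : |b - c| ≤ δ) (hbc' : |b' - c| ≤ δ)
    (hδ : m * δ ^ 2 ≤ 1) :
    (b' - b) / 2 * m ≤ (walkStep c b' ^ m) (clip (2 * √m + 2)) 0 -
      (walkStep c b ^ m) (clip (2 * √m + 2)) 0 := by
  have hm' : (0 : ℝ) < m := by exact_mod_cast hm
  have hδ0 : 0 ≤ δ := (abs_nonneg _).trans hbc
  rw [walkStep_pow_sub_pow]
  have hsum : (b' - b) / 2 * m = ∑ i ∈ Finset.range m, (b' - b) / 2 * 1 := by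
    simp [mul_comm]
  rw [hsum]
  refine Finset.sum_le_sum fun i hi => mul_le_mul_of_nonneg_left ?_ (by linarith)
  have hR : (0 : ℝ) < 2 * √m := by positivity
  have key := walkStep_pow_mono (c := c) hb' i (walkStep_pow_mono (c := c) hb (m - 1 - i)
    (clip_sub_clip_lower hR hc))
  rw [walkStep_pow_parabola, walkStep_pow_parabola] at key
  refine le_trans ?_ (key 0)
  have hRsq : (2 * √(m : ℝ)) ^ 2 = 4 * m := by
    rw [mul_pow, Real.sq_sqrt hm'.le]
    norm_num
  have hcount : ((m - 1 - i : ℕ) : ℝ) + i ≤ m := by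
    have := Finset.mem_range.mp hi
    exact_mod_cast (by omega : m - 1 - i + i ≤ m)
  set x : ℝ := ((m - 1 - i : ℕ) : ℝ)
  have hx : 0 ≤ x := Nat.cast_nonneg _
  have hi0 : (0 : ℝ) ≤ i := Nat.cast_nonneg _
  have hmean : (0 + (0 + x * (b - c) + i * (b' - c))) ^ 2 ≤ (m : ℝ) := by
    have h₁ : |0 + (0 + x * (b - c) + i * (b' - c))| ≤ m * δ := by
      rw [zero_add, zero_add]
      refine (abs_add_le _ _).trans ?_
      rw [abs_mul, abs_mul, abs_of_nonneg hx, abs_of_nonneg hi0]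
      calc x * |b - c| + i * |b' - c| ≤ x * δ + i * δ := by gcongr
        _ = (x + i) * δ := by ring
        _ ≤ m * δ := by gcongr
    calc _ = |0 + (0 + x * (b - c) + i * (b' - c))| ^ 2 := (sq_abs _).symm
      _ ≤ (m * δ) ^ 2 := by gcongr
      _ = m * (m * δ ^ 2) := by ring
      _ ≤ m * 1 := by gcongr
      _ = m := mul_one _
  have hvar : 0 + x * (1 - b ^ 2) + i * (1 - b' ^ 2) ≤ (m : ℝ) := by
    nlinarith [mul_nonneg hx (sq_nonneg b), mul_nonneg hi0 (sq_nonneg b')]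
  rw [hRsq]
  have : 2 / (4 * (m : ℝ)) * ((0 + (0 + x * (b - c) + i * (b' - c))) ^ 2 +
      (0 + x * (1 - b ^ 2) + i * (1 - b' ^ 2))) ≤ 2 / (4 * m) * (m + m) := by gcongr
  have h₂ : 2 / (4 * (m : ℝ)) * (m + m) = 1 := by field_simp; norm_num
  linarith

/-- A drift far from `c` could violate the second-moment bound, so `b` is compared by monotonicity
with `c - δ` or `c + δ`, which lies between `b` and `c`. -/
theorem walkStep_pow_clip_abs_gap {c b δ : ℝ} {m : ℕ} (hm : 1 ≤ m) (hc : |c| ≤ 1)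
    (hb : |b| ≤ 1) (hδ0 : 0 ≤ δ) (hδ : m * δ ^ 2 ≤ 1) (h : δ ≤ |b - c|) :
    δ / 2 * m ≤ |(walkStep c b ^ m) (clip (2 * √m + 2)) 0 -
      (walkStep c c ^ m) (clip (2 * √m + 2)) 0| := by
  obtain ⟨hb₁, hb₂⟩ := abs_le.mp hb
  obtain ⟨hc₁, hc₂⟩ := abs_le.mp hc
  rcases le_abs'.mp h with h | h
  · have hd : |c - δ| ≤ 1 := abs_le.mpr ⟨by linarith, by linarith⟩
    have h₁ := walkStep_pow_clip_gap hm hc hd hc (by linarith) (δ := δ)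
      (by rw [abs_sub_comm]; simp [abs_of_nonneg hδ0]) (by simpa using hδ0) hδ
    have h₂ := walkStep_pow_clip_mono (c := c) (R := 2 * √m + 2) hb hd (by linarith) m
    rw [sub_sub_cancel] at h₁
    rw [abs_sub_comm]
    exact le_trans (by linarith) (le_abs_self _)
  · have hd : |c + δ| ≤ 1 := abs_le.mpr ⟨by linarith, by linarith⟩
    have h₁ := walkStep_pow_clip_gap hm hc hc hd (by linarith) (δ := δ)
      (by simpa using hδ0) (by simp [abs_of_nonneg hδ0]) hδ
    have h₂ := walkStep_pow_clip_mono (c := c) (R := 2 * √m + 2) hd hb (by linarith) m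
    rw [add_sub_cancel_left] at h₁
    exact le_trans (by linarith) (le_abs_self _)

/-! ### Random signs and anticoncentration. -/

/-- The real sign `±1` encoded by a Boolean. -/
def boolSign (b : Bool) : ℝ := if b then 1 else -1

/-- The mean of the sign vector `σ` under the distribution `p`. -/
noncomputable def meanSign {β : Type} [Fintype β] (p : PMF β) (σ : β → Bool) : ℝ :=
  expectation p fun x => boolSign (σ x)

theorem abs_meanSign_le {β : Type} [Fintype β] (p : PMF β) (σ : β → Bool) :
    |meanSign p σ| ≤ 1 := by
  refine abs_le.mpr ⟨?_, ?_⟩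
  · refine (expectation_const p (-1)).symm.trans_le (expectation_mono p fun x => ?_)
    unfold boolSign
    split_ifs <;> norm_num
  · refine (expectation_mono p fun x => ?_).trans_eq (expectation_const p 1)
    unfold boolSign
    split_ifs <;> norm_num

/-- A function of a sign is affine in it, so only the mean of the sign matters. -/
theorem expectation_sign_step {β : Type} [Fintype β] (p : PMF β) (σ : β → Bool) (c : ℝ)
    (f : ℝ → ℝ) (z : ℝ) :
    expectation p (fun x => f (z + (boolSign (σ x) - c))) = walkStep c (meanSign p σ) f z := by
  have h (x : β) : f (z + (boolSign (σ x) - c)) =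
      (f (z + (1 - c)) + f (z + (-1 - c))) / 2 +
        (f (z + (1 - c)) - f (z + (-1 - c))) / 2 * boolSign (σ x) := by
    unfold boolSign
    split_ifs <;> ring
  simp only [h, expectation_add, expectation_const_mul, expectation_const, walkStep_apply]
  change _ + _ * meanSign p σ = _
  ring

theorem expectation_sign_walk {β : Type} [Fintype β] (p : PMF β) (σ : β → Bool) (c : ℝ)
    (f : ℝ → ℝ) (m : ℕ) (z : ℝ) :
    expectation (productPMF fun _ : Fin m => p)
        (fun x => f (z + ∑ j, (boolSign (σ (x j)) - c))) =
      (walkStep c (meanSign p σ) ^ m) f z := by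
  induction m generalizing z with
  | zero => simp [expectation_const]
  | succ m ih =>
    rw [expectation_productPMF_succ, pow_succ', Module.End.mul_apply, ← expectation_sign_step]
    congr 1
    funext a
    rw [← ih]
    simp only [Fin.sum_univ_succ, Fin.cons_zero, Fin.cons_succ, add_assoc]

/-- The uniform distribution on sign vectors, with independent coordinates. -/
noncomputable def signPMF (k : ℕ) : PMF (Fin k → Bool) :=
  productPMF fun _ => PMF.uniformOfFintype Bool

theorem expectation_uniform_bool (f : Bool → ℝ) :
    expectation (PMF.uniformOfFintype Bool) f = (f true + f false) / 2 := by
  simp [expectation]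
  ring

theorem expectation_signPMF_sum_sq {k : ℕ} (d : Fin k → ℝ) :
    expectation (signPMF k) (fun σ => (∑ x, boolSign (σ x) * d x) ^ 2) = ∑ x, d x ^ 2 := by
  rw [signPMF, expectation_productPMF_sum_sq _ fun x b => boolSign b * d x]
  · simp [expectation_uniform_bool, boolSign]
  · simp [expectation_uniform_bool, boolSign]

/-- Averaging over the first sign kills the odd terms of the expanded fourth power; the recursion
then closes under the bound. -/
theorem expectation_signPMF_sum_pow_four_le {k : ℕ} (d : Fin k → ℝ) :
    expectation (signPMF k) (fun σ => (∑ x, boolSign (σ x) * d x) ^ 4) ≤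
      3 * (∑ x, d x ^ 2) ^ 2 := by
  induction k with
  | zero => simp [expectation_const]
  | succ k ih =>
    have h := ih fun x => d x.succ
    have h₂ := expectation_signPMF_sum_sq fun x : Fin k => d x.succ
    have hexp : expectation (signPMF (k + 1)) (fun σ => (∑ x, boolSign (σ x) * d x) ^ 4) =
        d 0 ^ 4 + 6 * d 0 ^ 2 * ∑ x : Fin k, d x.succ ^ 2 +
          expectation (signPMF k) fun σ => (∑ x, boolSign (σ x) * d x.succ) ^ 4 := by
      rw [← h₂, signPMF, expectation_productPMF_succ, expectation_uniform_bool,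
        ← expectation_add, ← expectation_const_mul,
        ← expectation_const (signPMF k) (d 0 ^ 4), ← expectation_add, ← expectation_add,
        div_eq_inv_mul]
      erw [← expectation_const_mul]
      congr 1
      funext σ
      simp only [Fin.sum_univ_succ, Fin.cons_zero, Fin.cons_succ, boolSign, if_true,
        Bool.false_eq_true, if_false]
      ring
    rw [hexp, Fin.sum_univ_succ]
    nlinarith [sq_nonneg (d 0 ^ 2)]

/-- A Paley–Zygmund bound: a random signed sum is rarely less than half its standard deviation. -/
theorem expectation_signPMF_small_le {k : ℕ} (d : Fin k → ℝ) {θ : ℝ} (hθ : 0 < θ)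
    (hd : 4 * θ ^ 2 ≤ ∑ x, d x ^ 2) :
    expectation (signPMF k) (fun σ => if |∑ x, boolSign (σ x) * d x| < θ then 1 else 0) ≤
      13 / 16 := by
  set v := ∑ x, d x ^ 2 with hv
  have hv0 : 0 < v := lt_of_lt_of_le (by positivity) hd
  -- A quartic majorant of the indicator: where `W ^ 2 ≤ v / 4` it is at least `2 * v`, and
  -- everywhere it is at least `(W ^ 2 - 4 * v) ^ 2 / (8 * v) ≥ 0`. Its mean is at most `(9/4 - 1 +
  -- 3/8) * v = 13/8 * v`.
  have key : expectation (signPMF k) (fun σ =>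
      2 * v * (if |∑ x, boolSign (σ x) * d x| < θ then 1 else 0)) ≤
      expectation (signPMF k) (fun σ => 9 / 4 * v + (-1 * (∑ x, boolSign (σ x) * d x) ^ 2 +
        1 / (8 * v) * (∑ x, boolSign (σ x) * d x) ^ 4)) := by
    refine expectation_mono _ fun σ => ?_
    set W := ∑ x, boolSign (σ x) * d x
    have hsq : 1 / (8 * v) * W ^ 4 - W ^ 2 + 2 * v = (W ^ 2 - 4 * v) ^ 2 / (8 * v) := by
      field_simp
      ring
    have hsq0 : 0 ≤ (W ^ 2 - 4 * v) ^ 2 / (8 * v) := by positivity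
    have hW4 : 0 ≤ 1 / (8 * v) * W ^ 4 := by positivity
    split_ifs with h
    · have hW : W ^ 2 ≤ θ ^ 2 := by
        rw [← sq_abs W]
        exact pow_le_pow_left₀ (abs_nonneg _) h.le 2
      linarith
    · linarith
  rw [expectation_const_mul, expectation_add, expectation_add, expectation_const,
    expectation_const_mul, expectation_const_mul, expectation_signPMF_sum_sq, ← hv] at key
  have h4 := mul_le_mul_of_nonneg_left (expectation_signPMF_sum_pow_four_le d)
    (show 0 ≤ 1 / (8 * v) by positivity)
  rw [← hv] at h4
  have h5 : 1 / (8 * v) * (3 * v ^ 2) = 3 / 8 * v := by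
    field_simp
  refine le_of_mul_le_mul_left ?_ (show 0 < 2 * v by positivity)
  linarith

theorem meanSign_sub_meanSign {k : ℕ} (p q : PMF (Fin k)) (σ : Fin k → Bool) :
    meanSign p σ - meanSign q σ = ∑ x, boolSign (σ x) * ((p x).toReal - (q x).toReal) := by
  simp only [meanSign, expectation, ← Finset.sum_sub_distrib]
  exact Finset.sum_congr rfl fun x _ => by ring

theorem four_mul_sq_dTV_le {k : ℕ} (p q : PMF (Fin k)) :
    4 * dTV p q ^ 2 ≤ k * ∑ x, ((p x).toReal - (q x).toReal) ^ 2 := by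
  have h := sq_sum_le_card_mul_sum_sq (s := Finset.univ)
    (f := fun x => |(p x).toReal - (q x).toReal|)
  simp only [sq_abs, Finset.card_univ, Fintype.card_fin] at h
  refine le_trans (le_of_eq ?_) h
  rw [dTV]
  ring

theorem expectation_signPMF_meanSign_close_le {k : ℕ} [NeZero k] (p q : PMF (Fin k)) {α : ℝ}
    (hα : 0 < α) (h : α ≤ dTV p q) :
    expectation (signPMF k)
      (fun σ => if |meanSign p σ - meanSign q σ| < α / √k then 1 else 0) ≤ 13 / 16 := by
  have hk : (0 : ℝ) < k := by exact_mod_cast Nat.pos_of_neZero k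
  simp only [meanSign_sub_meanSign]
  refine expectation_signPMF_small_le _ (by positivity) ?_
  rw [div_pow, Real.sq_sqrt hk.le, ← mul_div_assoc, div_le_iff₀ hk, mul_comm (Finset.sum _ _)]
  refine le_trans ?_ (four_mul_sq_dTV_le p q)
  gcongr

/-! ### Private bits and their counts. -/

/-- The distribution of a bit that is `true` with probability `r`. -/
noncomputable def bitPMF (r : unitInterval) : PMF Bool :=
  PMF.ofFintype (fun b => ENNReal.ofReal (if b then r else 1 - r)) (by
    rw [Fintype.sum_bool, ← ENNReal.ofReal_add (by simpa using r.2.1) (by simpa using r.2.2)]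
    simp)

theorem toReal_bitPMF (r : unitInterval) (b : Bool) :
    (bitPMF r b).toReal = if b then (r : ℝ) else 1 - r := by
  rw [bitPMF, PMF.ofFintype_apply, ENNReal.toReal_ofReal]
  split_ifs
  · exact r.2.1
  · linarith [r.2.2]

/-- Both outcomes have probability between `(1 - κ) / 2` and `(1 + κ) / 2`, so the likelihood ratio
is at most `(1 + κ) / (1 - κ)`. -/
theorem isLDP_bitPMF {D : Type} {ε κ : ℝ} (r : D → unitInterval)
    (hr : ∀ x, |(r x : ℝ) - 1 / 2| ≤ κ / 2) (hκ : 1 + κ ≤ Real.exp ε * (1 - κ)) :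
    IsLDP ε fun x => bitPMF (r x) := by
  intro x x' y
  rw [← ENNReal.toReal_le_toReal (PMF.apply_ne_top _ _)
    (ENNReal.mul_ne_top ENNReal.ofReal_ne_top (PMF.apply_ne_top _ _)), ENNReal.toReal_mul,
    ENNReal.toReal_ofReal (Real.exp_pos ε).le, toReal_bitPMF, toReal_bitPMF]
  obtain ⟨h₁, h₂⟩ := abs_le.mp (hr x)
  obtain ⟨h₃, h₄⟩ := abs_le.mp (hr x')
  have key {s t : ℝ} (hs : s ≤ (1 + κ) / 2) (ht : (1 - κ) / 2 ≤ t) : s ≤ Real.exp ε * t := by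
    have := mul_le_mul_of_nonneg_left ht (Real.exp_pos ε).le
    linarith
  split_ifs
  · exact key (by linarith) (by linarith)
  · exact key (by linarith) (by linarith)

/-- The real number `0` or `1` encoded by a Boolean. -/
def boolIndicator (b : Bool) : ℝ := if b then 1 else 0

theorem expectation_bitPMF_boolIndicator (r : unitInterval) :
    expectation (bitPMF r) boolIndicator = r := by
  simp [expectation, toReal_bitPMF, boolIndicator]

/-- The empirical count of ones in a set of independent bits is concentrated. -/
theorem expectation_count_deviation_le {n : ℕ} (w : Fin n → PMF Bool) (A : Finset (Fin n))
    {τ : ℝ} (hτ : 0 < τ) :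
    expectation (productPMF w) (fun y =>
      if τ ≤ |∑ i ∈ A, (boolIndicator (y i) - expectation (w i) boolIndicator)| then 1 else 0) ≤
      A.card / τ ^ 2 := by
  refine expectation_indicator_le_div_sq _ _ hτ ?_
  have h := expectation_productPMF_sum_sq w
    (fun i b => if i ∈ A then boolIndicator b - expectation (w i) boolIndicator else 0)
    (fun i => by
      split_ifs
      · simp only [sub_eq_add_neg, expectation_add, expectation_const, add_neg_cancel]
      · exact expectation_const _ _)
  simp only [Finset.sum_ite_mem, Finset.univ_inter] at h
  rw [h, ← nsmul_one, ← Finset.sum_const, ← Finset.sum_subset (Finset.subset_univ A)]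
  · refine Finset.sum_le_sum fun i hi => ?_
    refine (expectation_mono _ fun b => ?_).trans_eq (expectation_const (w i) 1)
    have h₀ : 0 ≤ expectation (w i) boolIndicator :=
      (expectation_const (w i) 0).symm.trans_le (expectation_mono _ fun b => by
        unfold boolIndicator; split_ifs <;> norm_num)
    have h₁ : expectation (w i) boolIndicator ≤ 1 :=
      (expectation_mono _ fun b => by
        unfold boolIndicator; split_ifs <;> norm_num).trans_eq (expectation_const (w i) 1)
    rw [if_pos hi, ← sq_abs]
    refine pow_le_one₀ (abs_nonneg _) (abs_le.mpr ?_)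
    unfold boolIndicator at h₀ h₁ ⊢
    split_ifs <;> constructor <;> linarith
  · intro i _ hi
    simp [hi, expectation_const]

/-! ### The tester and its error probabilities. -/

section Protocol

variable {k m : ℕ}

/-- The statistic on which a user's bit depends: the truncated deviation of the sum of the signs
of its samples from the mean under the uniform distribution, scaled to `[-1, 1]`. -/
noncomputable def signStatistic [NeZero k] (σ : Fin k → Bool) (x : Fin m → Fin k) : ℝ :=
  clip (2 * √m + 2)
    (∑ j, (boolSign (σ (x j)) - meanSign (PMF.uniformOfFintype (Fin k)) σ)) / (2 * √m + 2)

theorem abs_signStatistic_le [NeZero k] (σ : Fin k → Bool) (x : Fin m → Fin k) :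
    |signStatistic σ x| ≤ 1 := by
  have hM : 0 < 2 * √(m : ℝ) + 2 := by positivity
  rw [signStatistic, abs_div, abs_of_pos hM, div_le_one hM]
  exact abs_clip_le hM.le _

/-- The probability that a user with samples `x` sends `true`. -/
noncomputable def responseProb [NeZero k] (κ : unitInterval) (σ : Fin k → Bool)
    (x : Fin m → Fin k) : unitInterval :=
  ⟨1 / 2 + κ / 2 * signStatistic σ x, by
    obtain ⟨h₁, h₂⟩ := abs_le.mp (abs_signStatistic_le σ x)
    have h₃ := κ.2.1
    have h₄ := κ.2.2
    constructor <;> nlinarith⟩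

theorem abs_responseProb_sub_le [NeZero k] (κ : unitInterval) (σ : Fin k → Bool)
    (x : Fin m → Fin k) : |(responseProb κ σ x : ℝ) - 1 / 2| ≤ κ / 2 := by
  rw [responseProb, add_sub_cancel_left, abs_mul, abs_of_nonneg (by linarith [κ.2.1])]
  exact mul_le_of_le_one_right (by linarith [κ.2.1]) (abs_signStatistic_le σ x)

/-- The law of a user's bit when its samples have distribution `p`. -/
noncomputable def responseLaw [NeZero k] (m : ℕ) (κ : unitInterval) (p : PMF (Fin k))
    (σ : Fin k → Bool) : PMF Bool :=
  (productPMF fun _ : Fin m => p).bind fun x => bitPMF (responseProb κ σ x)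

theorem expectation_responseLaw [NeZero k] (κ : unitInterval) (p : PMF (Fin k))
    (σ : Fin k → Bool) :
    expectation (responseLaw m κ p σ) boolIndicator = 1 / 2 + κ / 2 / (2 * √m + 2) *
      (walkStep (meanSign (PMF.uniformOfFintype (Fin k)) σ) (meanSign p σ) ^ m)
        (clip (2 * √m + 2)) 0 := by
  rw [responseLaw, expectation_bind, ← expectation_sign_walk, ← expectation_const_mul,
    ← expectation_const (productPMF fun _ : Fin m => p) (1 / 2), ← expectation_add]
  congr 1
  funext x
  rw [expectation_bitPMF_boolIndicator, responseProb]
  simp only [signStatistic, zero_add]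
  ring

theorem expectation_responseLaw_gap [NeZero k] (κ : unitInterval) (p : PMF (Fin k))
    (σ : Fin k → Bool) {δ : ℝ} (hm : 1 ≤ m) (hδ0 : 0 ≤ δ) (hδ : m * δ ^ 2 ≤ 1)
    (h : δ ≤ |meanSign p σ - meanSign (PMF.uniformOfFintype (Fin k)) σ|) :
    κ * δ * √m / 16 ≤ |expectation (responseLaw m κ p σ) boolIndicator -
      expectation (responseLaw m κ (PMF.uniformOfFintype (Fin k)) σ) boolIndicator| := by
  have hgap := walkStep_pow_clip_abs_gap hm
    (abs_meanSign_le (PMF.uniformOfFintype (Fin k)) σ) (abs_meanSign_le p σ) hδ0 hδ h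
  have hκ := κ.2.1
  have hm1 : (1 : ℝ) ≤ √m := Real.one_le_sqrt.mpr (by exact_mod_cast hm)
  rw [expectation_responseLaw, expectation_responseLaw, add_sub_add_left_eq_sub, ← mul_sub,
    abs_mul, abs_of_nonneg (by positivity)]
  calc κ * δ * √m / 16 = κ / 2 / (4 * √m) * (δ / 2 * (√m * √m)) := by
        field_simp
        ring
    _ = κ / 2 / (4 * √m) * (δ / 2 * m) := by rw [Real.mul_self_sqrt (Nat.cast_nonneg m)]
    -- Here `2 * √m + 2 ≤ 4 * √m`, because `1 ≤ m`.
    _ ≤ κ / 2 / (2 * √m + 2) * (δ / 2 * m) := by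
        gcongr
        linarith
    _ ≤ _ := by gcongr

/-- The users in group `t`, when groups are laid out by an embedding `e`. -/
def groupUsers {n T N : ℕ} (e : Fin T × Fin N ↪ Fin n) (t : Fin T) : Finset (Fin n) :=
  Finset.univ.map ⟨fun j => e (t, j), fun _ _ h => (Prod.ext_iff.mp (e.injective h)).2⟩

/-- The group of a user, with a default value for users outside the range of `e`. -/
noncomputable def userGroup {n T N : ℕ} [NeZero T] (e : Fin T × Fin N ↪ Fin n) : Fin n → Fin T :=
  Function.extend e Prod.fst 0

theorem card_groupUsers {n T N : ℕ} (e : Fin T × Fin N ↪ Fin n) (t : Fin T) :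
    (groupUsers e t).card = N := by
  simp [groupUsers]

theorem userGroup_eq_of_mem {n T N : ℕ} [NeZero T] (e : Fin T × Fin N ↪ Fin n) {t : Fin T}
    {i : Fin n} (hi : i ∈ groupUsers e t) : userGroup e i = t := by
  obtain ⟨j, -, rfl⟩ := Finset.mem_map.mp hi
  exact e.injective.extend_apply _ _ (t, j)

/-- The deviation of the number of ones in group `t` from its mean under the uniform
distribution. -/
noncomputable def groupDeviation [NeZero k] (m : ℕ) {n T N : ℕ} (e : Fin T × Fin N ↪ Fin n)
    (κ : unitInterval) (s : Fin T → Fin k → Bool) (t : Fin T) (y : Fin n → Bool) : ℝ :=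
  ∑ i ∈ groupUsers e t, (boolIndicator (y i) -
    expectation (responseLaw m κ (PMF.uniformOfFintype (Fin k)) (s t)) boolIndicator)

open Classical in
/-- The users are split into groups; each group uses its own public random signs, and the server
accepts if in every group the number of ones is within `τ` of its mean under the uniform
distribution. -/
noncomputable def signTester [NeZero k] (m : ℕ) {n T N : ℕ} [NeZero T]
    (e : Fin T × Fin N ↪ Fin n) (κ : unitInterval) (τ : ℝ) : PublicCoinProtocol n m k Bool where
  Seed := Fin T → Fin k → Bool
  coin := productPMF fun _ => signPMF k
  randomizer i s x := bitPMF (responseProb κ (s (userGroup e i)) x)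
  referee s y := decide (∀ t, |groupDeviation m e κ s t y| < τ)

theorem signTester_isUserLevelLDP [NeZero k] {n T N : ℕ} [NeZero T]
    (e : Fin T × Fin N ↪ Fin n) {κ : unitInterval} {ε : ℝ} (τ : ℝ)
    (hκ : 1 + κ ≤ Real.exp ε * (1 - κ)) : (signTester (k := k) m e κ τ).IsUserLevelLDP ε :=
  fun i s => isLDP_bitPMF (κ := κ) (fun x => responseProb κ (s (userGroup e i)) x)
    (abs_responseProb_sub_le κ _) hκ

/-- The law of all messages of the users given the seed. -/
noncomputable def messageLaw [NeZero k] (m : ℕ) {n T N : ℕ} [NeZero T]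
    (e : Fin T × Fin N ↪ Fin n) (κ : unitInterval) (p : PMF (Fin k))
    (s : Fin T → Fin k → Bool) : PMF (Fin n → Bool) :=
  productPMF fun i => responseLaw m κ p (s (userGroup e i))

open Classical in
theorem signTester_decisionLaw [NeZero k] {n T N : ℕ} [NeZero T]
    (e : Fin T × Fin N ↪ Fin n) (κ : unitInterval) (τ : ℝ) (p : PMF (Fin k)) (b : Bool) :
    ((signTester m e κ τ).decisionLaw p b).toReal =
      expectation (productPMF fun _ : Fin T => signPMF k) fun s =>
        expectation (messageLaw m e κ p s) fun y =>
          if decide (∀ t, |groupDeviation m e κ s t y| < τ) = b then 1 else 0 := by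
  have h : (signTester m e κ τ).decisionLaw p =
      (productPMF fun _ : Fin T => signPMF k).bind fun s =>
        (messageLaw m e κ p s).map fun y => decide (∀ t, |groupDeviation m e κ s t y| < τ) := by
    unfold PublicCoinProtocol.decisionLaw messageLaw responseLaw
    refine congrArg _ (funext fun s => ?_)
    rw [← productPMF_bind (fun _ => productPMF fun _ : Fin m => p)
      (fun i x => bitPMF (responseProb κ (s (userGroup e i)) x)), PMF.map_bind]
    rfl
  rw [h, toReal_apply_eq_expectation, expectation_bind]
  exact congrArg _ (funext fun s => expectation_map _ _ _)

open Classical in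
/-- In each group, the count of ones is concentrated around its mean. -/
theorem expectation_messageLaw_deviation_le [NeZero k] {n T N : ℕ} [NeZero T]
    (e : Fin T × Fin N ↪ Fin n) (κ : unitInterval) (p : PMF (Fin k))
    (s : Fin T → Fin k → Bool) (t : Fin T) {τ : ℝ} (hτ : 0 < τ) :
    expectation (messageLaw m e κ p s) (fun y => if τ ≤ |groupDeviation m e κ s t y -
      N * (expectation (responseLaw m κ p (s t)) boolIndicator - expectation
        (responseLaw m κ (PMF.uniformOfFintype (Fin k)) (s t)) boolIndicator)| then 1 else 0) ≤
      N / τ ^ 2 := by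
  have h := expectation_count_deviation_le
    (fun i => responseLaw m κ p (s (userGroup e i))) (groupUsers e t) hτ
  rw [card_groupUsers] at h
  refine le_trans (le_of_eq ?_) h
  unfold messageLaw
  congr 1
  funext y
  have hy : groupDeviation m e κ s t y - N * (expectation (responseLaw m κ p (s t)) boolIndicator -
      expectation (responseLaw m κ (PMF.uniformOfFintype (Fin k)) (s t)) boolIndicator) =
      ∑ i ∈ groupUsers e t, (boolIndicator (y i) -
        expectation (responseLaw m κ p (s (userGroup e i))) boolIndicator) := by
    rw [Finset.sum_congr rfl fun i hi => by rw [userGroup_eq_of_mem e hi], groupDeviation,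
      Finset.sum_sub_distrib, Finset.sum_sub_distrib, Finset.sum_const, Finset.sum_const,
      card_groupUsers, nsmul_eq_mul, nsmul_eq_mul]
    ring
  rw [hy]

/-- Union bound over the groups, applied pointwise to indicators for each fixed seed. -/
theorem signTester_accepts_uniform [NeZero k] {n T N : ℕ} [NeZero T]
    (e : Fin T × Fin N ↪ Fin n) (κ : unitInterval) {τ : ℝ} (hτ : 0 < τ) :
    1 - T * (N / τ ^ 2) ≤
      ((signTester m e κ τ).decisionLaw (PMF.uniformOfFintype (Fin k)) true).toReal := by
  classical
  rw [signTester_decisionLaw, ← expectation_const (productPMF fun _ : Fin T => signPMF k)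
    (1 - T * (N / τ ^ 2))]
  refine expectation_mono _ fun s => ?_
  have hdev (t : Fin T) := expectation_messageLaw_deviation_le (m := m) e κ
    (PMF.uniformOfFintype (Fin k)) s t hτ
  simp only [sub_self, mul_zero, sub_zero] at hdev
  have hsum := Finset.sum_le_sum fun t (_ : t ∈ Finset.univ) => hdev t
  rw [← expectation_sum, Finset.sum_const, Finset.card_univ, Fintype.card_fin,
    nsmul_eq_mul] at hsum
  rw [sub_le_iff_le_add]
  refine (expectation_const (messageLaw m e κ (PMF.uniformOfFintype (Fin k)) s) 1).symm.trans_le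
    (le_trans ?_ (add_le_add_right hsum _))
  rw [← expectation_add]
  refine expectation_mono _ fun y => ?_
  have hnn (t : Fin T) : (0 : ℝ) ≤ if τ ≤ |groupDeviation m e κ s t y| then 1 else 0 := by
    split_ifs <;> norm_num
  by_cases hy : ∀ t, |groupDeviation m e κ s t y| < τ
  · rw [if_pos (decide_eq_true hy)]
    linarith [Finset.sum_nonneg fun t (_ : t ∈ Finset.univ) => hnn t]
  · rw [if_neg (by simpa using hy), zero_add]
    push Not at hy
    obtain ⟨t, ht⟩ := hy
    have := Finset.single_le_sum (fun t _ => hnn t) (Finset.mem_univ t)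
    rwa [if_pos ht] at this

/-- Either every group drew uninformative signs, with probability at most `(13 / 16) ^ T` by
independence, or some group's mean count is shifted by at least `2 * τ`; accepting then forces a
deviation of at least `τ` from the true mean in that group. -/
theorem signTester_rejects_far [NeZero k] {n T N : ℕ} [NeZero T]
    (e : Fin T × Fin N ↪ Fin n) (κ : unitInterval) {τ α : ℝ} (hτ : 0 < τ) (hα : 0 < α)
    (hm : 1 ≤ m) (hδ : m * (α / √k) ^ 2 ≤ 1)
    (hgap : 2 * τ ≤ N * (κ * (α / √k) * √m / 16)) (p : PMF (Fin k))
    (hp : α ≤ dTV p (PMF.uniformOfFintype (Fin k))) :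
    1 - (13 / 16) ^ T - N / τ ^ 2 ≤ ((signTester m e κ τ).decisionLaw p false).toReal := by
  classical
  set u := PMF.uniformOfFintype (Fin k)
  let bad (σ : Fin k → Bool) : ℝ := if |meanSign p σ - meanSign u σ| < α / √k then 1 else 0
  have hbad0 (σ : Fin k → Bool) : 0 ≤ bad σ := by
    simp only [bad]
    split_ifs <;> norm_num
  have hbad : expectation (productPMF fun _ : Fin T => signPMF k)
      (fun s => ∏ t, bad (s t)) ≤ (13 / 16) ^ T := by
    rw [expectation_productPMF_prod _ fun _ => bad, Finset.prod_const, Finset.card_univ,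
      Fintype.card_fin]
    refine pow_le_pow_left₀ ?_ (expectation_signPMF_meanSign_close_le p u hα hp) T
    exact (expectation_const _ 0).symm.trans_le (expectation_mono _ hbad0)
  rw [signTester_decisionLaw]
  suffices h : 1 - N / τ ^ 2 ≤ expectation (productPMF fun _ : Fin T => signPMF k)
      (fun s => ∏ t, bad (s t)) + expectation (productPMF fun _ : Fin T => signPMF k) fun s =>
        expectation (messageLaw m e κ p s) fun y =>
          if decide (∀ t, |groupDeviation m e κ s t y| < τ) = false then 1 else 0 by
    linarith
  rw [← expectation_add, ← expectation_const (productPMF fun _ : Fin T => signPMF k)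
    (1 - N / τ ^ 2)]
  refine expectation_mono _ fun s => ?_
  have hNτ : 0 ≤ N / τ ^ 2 := by positivity
  by_cases hs : ∀ t, |meanSign p (s t) - meanSign u (s t)| < α / √k
  · have h₁ : ∏ t, bad (s t) = 1 := Finset.prod_eq_one fun t _ => if_pos (hs t)
    have h₂ : (0 : ℝ) ≤ expectation (messageLaw m e κ p s) fun y =>
        if decide (∀ t, |groupDeviation m e κ s t y| < τ) = false then 1 else 0 :=
      (expectation_const _ 0).symm.trans_le (expectation_mono _ fun y => by
        split_ifs <;> norm_num)
    linarith
  · push Not at hs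
    obtain ⟨t, ht⟩ := hs
    have h₁ : 0 ≤ ∏ t, bad (s t) := Finset.prod_nonneg fun t _ => hbad0 _
    have hdev := expectation_messageLaw_deviation_le (m := m) e κ p s t hτ
    have hq := expectation_responseLaw_gap κ p (s t) hm (by positivity) hδ ht
    set g := expectation (responseLaw m κ p (s t)) boolIndicator -
      expectation (responseLaw m κ u (s t)) boolIndicator
    have hN : 2 * τ ≤ |N * g| := by
      rw [abs_mul, Nat.abs_cast]
      exact hgap.trans (mul_le_mul_of_nonneg_left hq (Nat.cast_nonneg N))
    refine le_trans ?_ (le_add_of_nonneg_left h₁)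
    rw [sub_le_iff_le_add]
    refine (expectation_const (messageLaw m e κ p s) 1).symm.trans_le (le_trans ?_
      (add_le_add_right hdev _))
    rw [← expectation_add]
    refine expectation_mono _ fun y => ?_
    by_cases hy : |groupDeviation m e κ s t y| < τ
    · have hfar : τ ≤ |groupDeviation m e κ s t y - N * g| := by
        have := abs_sub_abs_le_abs_sub (N * g) (groupDeviation m e κ s t y)
        rw [abs_sub_comm] at this
        linarith
      rw [if_pos hfar]
      exact le_add_of_nonneg_left (by split_ifs <;> norm_num)
    · rw [if_pos (decide_eq_false fun h => hy (h t))]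
      exact le_add_of_nonneg_right (by split_ifs <;> norm_num)

end Protocol

/-! ### Choice of parameters. -/

theorem one_add_le_exp_mul_one_sub {ε : ℝ} (hε : 0 < ε) :
    1 + min ε 1 / 4 ≤ Real.exp ε * (1 - min ε 1 / 4) := by
  have h₁ : min ε 1 ≤ 1 := min_le_right _ _
  have h₀ : 0 < min ε 1 := lt_min hε one_pos
  have h₂ : 1 + min ε 1 ≤ Real.exp ε := by
    linarith [Real.add_one_le_exp ε, min_le_left ε 1]
  nlinarith

end UserLevelLDP

theorem mainTheorem3 :
    ∃ C : ℝ, 0 < C ∧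
      ∀ (k m : ℕ) [NeZero k] (α ε : ℝ),
        0 < α → α ≤ 1 → 0 < ε → 1 ≤ m → (m : ℝ) ≤ Real.sqrt k / α ^ 2 →
          ∃ n₀ : ℕ, (n₀ : ℝ) ≤ C * (k / (m * α ^ 2 * (min ε 1) ^ 2)) ∧
            ∀ n : ℕ, n₀ ≤ n →
              ∃ P : UserLevelLDP.PublicCoinProtocol n m k Bool,
                P.IsUserLevelLDP ε ∧ P.IsUniformityTester α := by
  -- The constant is `10 * 121 * 4096`: ten groups, at most `121 / γ ^ 2` users in each, and `4096 =
  -- (4 * 16) ^ 2` from `γ`.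
  refine ⟨4956160, by norm_num, fun k m _ α ε hα _ hε hm hmk => ?_⟩
  have hk1 : (1 : ℝ) ≤ k := by exact_mod_cast Nat.pos_of_neZero k
  have hk : (0 : ℝ) < k := by linarith
  have hm0 : (0 : ℝ) < m := by exact_mod_cast hm
  set η := min ε 1 with hη
  have hη0 : 0 < η := lt_min hε one_pos
  have hη1 : η ≤ 1 := min_le_right _ _
  -- The bound on `m` enters only through `m * α ^ 2 ≤ √k ≤ k`.
  have hδ : m * (α / √k) ^ 2 ≤ 1 := by
    rw [div_pow, Real.sq_sqrt hk.le, ← mul_div_assoc, div_le_one hk]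
    rw [le_div_iff₀ (by positivity)] at hmk
    exact hmk.trans (Real.sqrt_le_self_iff.mpr (Or.inr hk1))
  let κ : unitInterval := ⟨η / 4, by constructor <;> linarith⟩
  set γ := η / 4 * (α / √k) * √m / 16 with hγ
  have hγ0 : 0 < γ := by positivity
  have hγsq : γ ^ 2 = η ^ 2 * (m * (α / √k) ^ 2) / 4096 := by
    have : γ ^ 2 = η ^ 2 * (√m ^ 2 * (α / √k) ^ 2) / 4096 := by
      rw [hγ]
      ring
    rwa [Real.sq_sqrt hm0.le] at this
  have hγ1 : γ ^ 2 ≤ 1 := by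
    have : η ^ 2 * (m * (α / √k) ^ 2) ≤ 1 :=
      mul_le_one₀ (pow_le_one₀ hη0.le hη1) (by positivity) hδ
    linarith
  have hγinv : 1 / γ ^ 2 = 4096 * (k / (m * α ^ 2 * η ^ 2)) := by
    rw [hγsq, div_pow, Real.sq_sqrt hk.le]
    field_simp
  -- The value 120 makes each group's Chebyshev error at most `4 / 120 = 1 / 30`, so ten groups err
  -- with total probability at most 1/3 under uniformity.
  set N := ⌈120 / γ ^ 2⌉₊ with hN
  have hN1 : 120 / γ ^ 2 ≤ N := Nat.le_ceil _
  have hN0 : (0 : ℝ) < N := lt_of_lt_of_le (by positivity) hN1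
  have hN2 : (N : ℝ) ≤ 121 / γ ^ 2 := by
    have h₁ : (N : ℝ) < 120 / γ ^ 2 + 1 := Nat.ceil_lt_add_one (by positivity)
    have h₂ : 1 ≤ 1 / γ ^ 2 := (one_le_div (by positivity)).mpr hγ1
    have h₃ : 121 / γ ^ 2 = 120 / γ ^ 2 + 1 / γ ^ 2 := by ring
    linarith
  refine ⟨10 * N, ?_, fun n hn => ?_⟩
  · push_cast
    have : 121 / γ ^ 2 = 121 * (1 / γ ^ 2) := by ring
    rw [this, hγinv] at hN2
    linarith
  -- Users outside the range of `e` still send private bits, which the referee ignores; hence every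
  -- `n ≥ 10 * N` works.
  obtain ⟨e⟩ : Nonempty (Fin 10 × Fin N ↪ Fin n) :=
    Function.Embedding.nonempty_of_card_le (by simpa using hn)
  -- The threshold is half the guaranteed shift `N * γ` of an informative group's count.
  set τ := N * γ / 2 with hτ
  have hτ0 : 0 < τ := by positivity
  have hcheb : N / τ ^ 2 ≤ 1 / 30 := by
    have : N / τ ^ 2 = 4 / (N * γ ^ 2) := by
      rw [hτ]
      field_simp
      norm_num
    rw [this, div_le_div_iff₀ (by positivity) (by norm_num)]
    rw [div_le_iff₀ (by positivity)] at hN1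
    linarith
  have h23 (x : ℝ≥0∞) (hx : x ≠ ⊤) (h : 2 / 3 ≤ x.toReal) : 2 / 3 ≤ x := by
    rw [← ENNReal.toReal_le_toReal (by finiteness) hx]
    simpa using h
  refine ⟨UserLevelLDP.signTester m e κ τ,
    UserLevelLDP.signTester_isUserLevelLDP e τ (UserLevelLDP.one_add_le_exp_mul_one_sub hε),
    h23 _ (PMF.apply_ne_top _ _) ?_, fun p hp => h23 _ (PMF.apply_ne_top _ _) ?_⟩
  · have := UserLevelLDP.signTester_accepts_uniform (k := k) (m := m) e κ hτ0
    push_cast at this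
    linarith
  · have := UserLevelLDP.signTester_rejects_far (m := m) e κ hτ0 hα hm hδ
      (le_of_eq (by rw [hτ]; ring)) p hp
    -- Ten groups bring the rejection error to at most `1/6 + 1/30 = 1/5`.
    have hpow : ((13 : ℝ) / 16) ^ 10 ≤ 1 / 6 := by norm_num
    linarith
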